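/- Let $N\ge 1$, let $\Omega\subset\mathbb{R}^N$ be a bounded domain, and let $1<q<p$, $r>p$, $s>p$ be real numbers with $r+s<p^*$, where $p^*=\frac{pN}{N-p}$ if $p<N$ and $p^*=\infty$ if $N\le p$. Let $f,g,h\in C(\overline\Omega)$ be such that $f^\pm=\max\{\pm f,0\}\not\equiv 0$, $g^\pm=\max\{\pm g,0\}\not\equiv0$ and $h^\pm=\max\{\pm h,0\}\not\equiv0$. Put $W=W_0^{1,p}(\Omega)\times W_0^{1,p}(\Omega)$, $\|(u,v)\|=\left(\int_\Omega|\nabla u|^p+\int_\Omega|\nabla v|^p\right)^{1/p}$, and for $\lambda,\mu\in\mathbb{R}$ and $(u,v)\in W$ $$J_{\lambda,\mu}(u,v)=\frac1p\|(u,v)\|^p-\frac1q\left(\lambda\int_\Omega f|u|^q+\mu\int_\Omega g|v|^q\right)-\frac1{r+s}\int_\Omega h|u|^r|v|^s .$$ Let $$M_{\lambda,\mu}=\{(u,v)\in W\setminus\{(0,0)\} : \langle J_{\lambda,\mu}'(u,v),(u,v)\rangle=0\}$$ be the Nehari manifold, let $\psi_{\lambda,\mu}(u,v)=\langle J_{\lambda,\mu}'(u,v),(u,v)\rangle$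 for $(u,v)\in W$, and let $$M^0_{\lambda,\mu}=\{(u,v)\in M_{\lambda,\mu} : \langle\psi_{\lambda,\mu}'(u,v),(u,v)\rangle=0\}.$$ Here $\langle F'(w),w\rangle$ is the derivative of a functional $F$ on $W$ at $w$ in the direction $w$. Then there exist $\lambda_0>0$ and $\mu_0>0$ such that $M^0_{\lambda,\mu}=\emptyset$ for all real $\lambda,\mu$ with $0<|\lambda|<\lambda_0$ and $0<|\mu|<\mu_0$. -/

import Mathlib

open MeasureTheory Set
open scoped ENNReal ContDiff

noncomputable section

namespace NehariSystem

/-- `ℝ^N` with its Euclidean norm. -/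
abbrev Eucl (N : ℕ) : Type := EuclideanSpace ℝ (Fin N)

instance factOneLe (p : ℝ) [hp : Fact (1 < p)] : Fact (1 ≤ ENNReal.ofReal p) :=
  ⟨by simpa using hp.out.le⟩

variable {N : ℕ}

/-- `φ ∈ C_c^∞(Ω)`. -/
structure IsTestFunction (Ω : Set (Eucl N)) (φ : Eucl N → ℝ) : Prop where
  smooth : ContDiff ℝ ∞ φ
  compact : HasCompactSupport φ
  supp : tsupport φ ⊆ Ω

/-- The space `L^p(Ω) × L^p(Ω; ℝ^N)`, in which a Sobolev function `u` is represented by the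
pair `(u, ∇u)`. -/
abbrev LpPair (Ω : Set (Eucl N)) (p : ℝ) : Type :=
  Lp ℝ (ENNReal.ofReal p) (volume.restrict Ω) × Lp (Eucl N) (ENNReal.ofReal p) (volume.restrict Ω)

/-- `G` is the weak gradient of `u` on `Ω`. -/
def IsWeakGradient (Ω : Set (Eucl N)) (u : Eucl N → ℝ) (G : Eucl N → Eucl N) : Prop :=
  ∀ φ : Eucl N → ℝ, IsTestFunction Ω φ →
    ∫ x in Ω, u x • gradient φ x = - ∫ x in Ω, φ x • G x

lemma IsTestFunction.continuous_gradient {Ω : Set (Eucl N)} {φ : Eucl N → ℝ}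
    (h : IsTestFunction Ω φ) : Continuous (gradient φ) :=
  (InnerProductSpace.toDual ℝ (Eucl N)).symm.continuous.comp
    (h.smooth.continuous_fderiv (by simp))

lemma IsTestFunction.compact_gradient {Ω : Set (Eucl N)} {φ : Eucl N → ℝ}
    (h : IsTestFunction Ω φ) : HasCompactSupport (gradient φ) :=
  (h.compact.fderiv ℝ).comp_left (g := (InnerProductSpace.toDual ℝ (Eucl N)).symm) (by simp)

lemma integrable_smul_gradient {Ω : Set (Eucl N)} {p : ℝ} [Fact (1 < p)]
    (u : Lp ℝ (ENNReal.ofReal p) (volume.restrict Ω)) {φ : Eucl N → ℝ}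
    (h : IsTestFunction Ω φ) : Integrable (fun x => u x • gradient φ x) (volume.restrict Ω) :=
  ((Lp.memLp u).locallyIntegrable (Fact.out : 1 ≤ ENNReal.ofReal p)
    ).integrable_smul_right_of_hasCompactSupport h.continuous_gradient h.compact_gradient

lemma integrable_smul_field {Ω : Set (Eucl N)} {p : ℝ} [Fact (1 < p)]
    (G : Lp (Eucl N) (ENNReal.ofReal p) (volume.restrict Ω)) {φ : Eucl N → ℝ}
    (h : IsTestFunction Ω φ) : Integrable (fun x => φ x • G x) (volume.restrict Ω) :=
  ((Lp.memLp G).locallyIntegrable (Fact.out : 1 ≤ ENNReal.ofReal p)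
    ).integrable_smul_left_of_hasCompactSupport h.smooth.continuous h.compact

/-- The Sobolev space `W^{1,p}(Ω)`: all pairs `(u, ∇u)` with `u ∈ L^p(Ω)` whose weak gradient
`∇u` is in `L^p(Ω; ℝ^N)`. -/
def W1p (Ω : Set (Eucl N)) (p : ℝ) [Fact (1 < p)] : Submodule ℝ (LpPair Ω p) where
  carrier := {w | IsWeakGradient Ω w.1 w.2}
  zero_mem' := by
    intro φ _
    have h1 : (fun x => (0 : LpPair Ω p).1 x • gradient φ x) =ᵐ[volume.restrict Ω] 0 := by
      filter_upwards [Lp.coeFn_zero ℝ (ENNReal.ofReal p) (volume.restrict Ω)] with x hx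
      simp only [Prod.fst_zero]
      rw [hx]
      simp
    have h2 : (fun x => φ x • (0 : LpPair Ω p).2 x) =ᵐ[volume.restrict Ω] 0 := by
      filter_upwards [Lp.coeFn_zero (Eucl N) (ENNReal.ofReal p) (volume.restrict Ω)] with x hx
      simp only [Prod.snd_zero]
      rw [hx]
      simp
    rw [integral_congr_ae h1, integral_congr_ae h2]
    simp
  add_mem' := by
    intro a b ha hb φ hφ
    have h1 : (fun x => (a + b).1 x • gradient φ x) =ᵐ[volume.restrict Ω]
        fun x => a.1 x • gradient φ x + b.1 x • gradient φ x := by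
      filter_upwards [Lp.coeFn_add a.1 b.1] with x hx
      rw [Prod.fst_add, hx, Pi.add_apply, add_smul]
    have h2 : (fun x => φ x • (a + b).2 x) =ᵐ[volume.restrict Ω]
        fun x => φ x • a.2 x + φ x • b.2 x := by
      filter_upwards [Lp.coeFn_add a.2 b.2] with x hx
      rw [Prod.snd_add, hx, Pi.add_apply, smul_add]
    rw [integral_congr_ae h1, integral_congr_ae h2,
      integral_add (integrable_smul_gradient a.1 hφ) (integrable_smul_gradient b.1 hφ),
      integral_add (integrable_smul_field a.2 hφ) (integrable_smul_field b.2 hφ),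
      ha φ hφ, hb φ hφ, neg_add]
  smul_mem' := by
    intro c a ha φ hφ
    have h1 : (fun x => (c • a).1 x • gradient φ x) =ᵐ[volume.restrict Ω]
        fun x => c • (a.1 x • gradient φ x) := by
      filter_upwards [Lp.coeFn_smul c a.1] with x hx
      rw [Prod.smul_fst, hx, Pi.smul_apply, smul_assoc]
    have h2 : (fun x => φ x • (c • a).2 x) =ᵐ[volume.restrict Ω]
        fun x => c • (φ x • a.2 x) := by
      filter_upwards [Lp.coeFn_smul c a.2] with x hx
      rw [Prod.smul_snd, hx, Pi.smul_apply, smul_comm]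
    rw [integral_congr_ae h1, integral_congr_ae h2, integral_smul, integral_smul, ha φ hφ,
      smul_neg]

/-- The classes `(φ, ∇φ)` of the test functions `φ ∈ C_c^∞(Ω)`. -/
def testPairs (Ω : Set (Eucl N)) (p : ℝ) : Submodule ℝ (LpPair Ω p) where
  carrier := {w | ∃ φ : Eucl N → ℝ, IsTestFunction Ω φ ∧
    w.1 =ᵐ[volume.restrict Ω] φ ∧ w.2 =ᵐ[volume.restrict Ω] gradient φ}
  zero_mem' := by
    refine ⟨0, ⟨contDiff_const, HasCompactSupport.zero, ?_⟩, Lp.coeFn_zero _ _ _, ?_⟩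
    · simp [tsupport]
    · filter_upwards [Lp.coeFn_zero (Eucl N) (ENNReal.ofReal p) (volume.restrict Ω)] with x hx
      simp only [Prod.snd_zero]
      rw [hx]
      simp [gradient]
  add_mem' := by
    rintro a b ⟨φ, hφ, h1, h2⟩ ⟨ψ, hψ, h3, h4⟩
    refine ⟨φ + ψ, ⟨hφ.smooth.add hψ.smooth, hφ.compact.add hψ.compact,
      (tsupport_add φ ψ).trans (union_subset hφ.supp hψ.supp)⟩,
      (Lp.coeFn_add a.1 b.1).trans (h1.add h3), (Lp.coeFn_add a.2 b.2).trans ?_⟩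
    filter_upwards [h2, h4] with x hx hy
    rw [Pi.add_apply, hx, hy]
    have d1 : DifferentiableAt ℝ φ x := (hφ.smooth.differentiable (by simp)) x
    have d2 : DifferentiableAt ℝ ψ x := (hψ.smooth.differentiable (by simp)) x
    simp only [gradient]
    rw [fderiv_add d1 d2, map_add]
  smul_mem' := by
    rintro c a ⟨φ, hφ, h1, h2⟩
    refine ⟨c • φ, ⟨hφ.smooth.const_smul c, hφ.compact.smul_left (f := fun _ => c),
      (tsupport_smul_subset_right (fun _ => c) φ).trans hφ.supp⟩,
      (Lp.coeFn_smul c a.1).trans (h1.const_smul c), (Lp.coeFn_smul c a.2).trans ?_⟩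
    filter_upwards [h2] with x hx
    rw [Pi.smul_apply, hx]
    have d1 : DifferentiableAt ℝ φ x := (hφ.smooth.differentiable (by simp)) x
    simp only [gradient]
    rw [fderiv_const_smul d1, map_smul]

/-- `W_0^{1,p}(Ω)`: the closure of `C_c^∞(Ω)` in `W^{1,p}(Ω)`. -/
def W01p (Ω : Set (Eucl N)) (p : ℝ) [Fact (1 < p)] : Submodule ℝ (LpPair Ω p) :=
  W1p Ω p ⊓ (testPairs Ω p).topologicalClosure

/-- `W = W_0^{1,p}(Ω) × W_0^{1,p}(Ω)`. -/
abbrev W (Ω : Set (Eucl N)) (p : ℝ) [Fact (1 < p)] : Type := W01p Ω p × W01p Ω p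

section Functionals

variable {Ω : Set (Eucl N)} {p : ℝ} [Fact (1 < p)]

/-- The function underlying an element of `W_0^{1,p}(Ω)`. -/
def fn (u : W01p Ω p) : Eucl N → ℝ := u.1.1

/-- The weak gradient of an element of `W_0^{1,p}(Ω)`. -/
def grad (u : W01p Ω p) : Eucl N → Eucl N := u.1.2

/-- `‖(u, v)‖ = (∫_Ω |∇u|^p + ∫_Ω |∇v|^p)^{1/p}`. -/
def normW (w : W Ω p) : ℝ :=
  ((∫ x in Ω, ‖grad w.1 x‖ ^ p) + ∫ x in Ω, ‖grad w.2 x‖ ^ p) ^ (1 / p)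

/-- The energy functional `J_{λ,μ}` on `W`. -/
def energy (q r s : ℝ) (f g h : Eucl N → ℝ) (lam mu : ℝ) (w : W Ω p) : ℝ :=
  1 / p * normW w ^ p
    - 1 / q * (lam * (∫ x in Ω, f x * |fn w.1 x| ^ q) + mu * ∫ x in Ω, g x * |fn w.2 x| ^ q)
    - 1 / (r + s) * ∫ x in Ω, h x * |fn w.1 x| ^ r * |fn w.2 x| ^ s

/-- `⟨F'(w), z⟩` for a functional `F` on `W`: the derivative of `F` at `w` in the direction `z`. -/
def pairing (F : W Ω p → ℝ) (w z : W Ω p) : ℝ := lineDeriv ℝ F w z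

/-- `ψ_{λ,μ}(w) = ⟨J_{λ,μ}'(w), w⟩`. -/
def psi (q r s : ℝ) (f g h : Eucl N → ℝ) (lam mu : ℝ) (w : W Ω p) : ℝ :=
  pairing (energy q r s f g h lam mu) w w

end Functionals

/-- The Nehari manifold `M_{λ,μ} = {w ∈ W \ {0} | ⟨J_{λ,μ}'(w), w⟩ = 0}`. -/
def nehari (Ω : Set (Eucl N)) (p : ℝ) [Fact (1 < p)] (q r s : ℝ) (f g h : Eucl N → ℝ)
    (lam mu : ℝ) : Set (W Ω p) :=
  {w | w ≠ 0 ∧ pairing (energy q r s f g h lam mu) w w = 0}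

/-- The degenerate part `M_{λ,μ}^0 = {w ∈ M_{λ,μ} | ⟨ψ_{λ,μ}'(w), w⟩ = 0}`. -/
def nehariZero (Ω : Set (Eucl N)) (p : ℝ) [Fact (1 < p)] (q r s : ℝ) (f g h : Eucl N → ℝ)
    (lam mu : ℝ) : Set (W Ω p) :=
  {w | w ∈ nehari Ω p q r s f g h lam mu ∧ pairing (psi q r s f g h lam mu) w w = 0}

/-- The critical Sobolev exponent: `p^* = pN/(N-p)` if `p < N`, and `p^* = ∞` if `N ≤ p`. -/
def criticalExponent (N : ℕ) (p : ℝ) : EReal :=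
  if p < N then ((p * N / (N - p) : ℝ) : EReal) else ⊤

/-- `f ∈ C(Ω̄)` with `f⁺ = max{f, 0} ≢ 0` and `f⁻ = max{-f, 0} ≢ 0`. -/
structure IsSignChangingWeight (Ω : Set (Eucl N)) (f : Eucl N → ℝ) : Prop where
  continuousOn : ContinuousOn f (closure Ω)
  pos_part : ∃ x ∈ closure Ω, max (f x) 0 ≠ 0
  neg_part : ∃ x ∈ closure Ω, max (-f x) 0 ≠ 0

end NehariSystem

end

noncomputable section

namespace NehariSystem

open Filter Topology NNReal

/-! ### The subcritical Sobolev inequality on `W01p`. -/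

section Sobolev

variable {N : ℕ} {Ω : Set (Eucl N)} {p : ℝ}

/-! Along a ray `t • w` with `t > 0` the energy is a combination of `t ^ p`, `t ^ q` and `t ^ (r +
s)`, so the radial derivatives are explicit and no Fréchet differentiability is needed. With `A =
normW w ^ p`, `B` the concave part and `H` the coupling part, a degenerate Nehari point satisfies `A
= B + H` and `p A = q B + (r + s) H` (`psi_eq`, `pairing_psi_self`). Eliminating one unknown at a
time gives `(p - q) A = (r + s - q) H` and `(r + s - p) A = (r + s - q) B`.

By Sobolev, `H ≤ C A ^ ((r + s) / p)` with `r + s > p`, so the first identity bounds `A` below by a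
constant independent of `lam` and `mu`. Also `B ≤ C (|lam| + |mu|) A ^ (q / p)` with `q < p`, so the
second forces `A` to be small when the parameters are. For small parameters the two are incompatible
(`exists_pos_forall_lt_rpow`). -/

lemma IsTestFunction.support_subset {φ : Eucl N → ℝ} (h : IsTestFunction Ω φ) :
    φ.support ⊆ Ω :=
  (subset_tsupport φ).trans h.supp

lemma IsTestFunction.support_fderiv_subset {φ : Eucl N → ℝ} (h : IsTestFunction Ω φ) :
    (fderiv ℝ φ).support ⊆ Ω :=
  (_root_.support_fderiv_subset ℝ).trans h.supp

lemma norm_gradient_eq_norm_fderiv (φ : Eucl N → ℝ) (x : Eucl N) :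
    ‖gradient φ x‖ = ‖fderiv ℝ φ x‖ := by
  simp [gradient]

lemma IsTestFunction.aestronglyMeasurable_fderiv {φ : Eucl N → ℝ} (h : IsTestFunction Ω φ)
    (μ : Measure (Eucl N)) : AEStronglyMeasurable (fderiv ℝ φ) μ :=
  (h.smooth.continuous_fderiv (by simp)).aestronglyMeasurable

lemma IsTestFunction.eLpNorm_fderiv_restrict {φ : Eucl N → ℝ} (h : IsTestFunction Ω φ) (a : ℝ≥0∞) :
    eLpNorm (fderiv ℝ φ) a (volume.restrict Ω) = eLpNorm (fderiv ℝ φ) a volume := by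
  have hs : (fun x => ‖fderiv ℝ φ x‖).support ⊆ Ω := fun x hx =>
    h.support_fderiv_subset fun h0 => hx (by simp only [h0, norm_zero])
  rw [← eLpNorm_norm (fderiv ℝ φ), ← eLpNorm_norm (fderiv ℝ φ),
    eLpNorm_restrict_eq_of_support_subset hs]

/-- On a set of finite measure, Lebesgue norms are monotone in the exponent, up to a constant. -/
lemma exists_eLpNorm_le_of_exponent_le {μ : Measure (Eucl N)} [IsFiniteMeasure μ] {a b : ℝ≥0∞}
    (ha : 1 ≤ a) (hab : a ≤ b) {F : Type*} [NormedAddCommGroup F] :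
    ∃ C : ℝ≥0, ∀ u : Eucl N → F, AEStronglyMeasurable u μ → eLpNorm u a μ ≤ C * eLpNorm u b μ := by
  have hexp : 0 ≤ 1 / a.toReal - 1 / b.toReal := by
    rcases eq_or_ne b ⊤ with rfl | hb
    -- Here `b.toReal = 0` and `1 / 0 = 0`, so the difference is just `1 / a.toReal`.
    · simp
    · have ha' : a ≠ ⊤ := ne_top_of_le_ne_top hb hab
      have h1 : 0 < a.toReal := ENNReal.toReal_pos (zero_lt_one.trans_le ha).ne' ha'
      exact sub_nonneg.2 (one_div_le_one_div_of_le h1 (ENNReal.toReal_mono hb hab))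
  have hfin : μ univ ^ (1 / a.toReal - 1 / b.toReal) ≠ ⊤ :=
    ENNReal.rpow_ne_top_of_nonneg hexp (measure_ne_top μ univ)
  refine ⟨(μ univ ^ (1 / a.toReal - 1 / b.toReal)).toNNReal, fun u hu => ?_⟩
  rw [ENNReal.coe_toNNReal hfin, mul_comm]
  exact eLpNorm_le_eLpNorm_mul_rpow_measure_univ hab hu

/-- In dimension one a compactly supported function is bounded by the integral of its
derivative. -/
lemma eLpNorm_top_le_eLpNorm_fderiv_one {φ : Eucl 1 → ℝ} (hφ : ContDiff ℝ 1 φ)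
    (hc : HasCompactSupport φ) :
    eLpNorm φ ⊤ volume ≤ eLpNorm (fderiv ℝ φ) 1 volume := by
  -- A volume-preserving isometry with the line, along which the fundamental theorem of calculus is
  -- transported.
  let e : ℝ ≃ₗᵢ[ℝ] Eucl 1 := (OrthonormalBasis.singleton (Fin 1) ℝ).repr
  have he : MeasurePreserving e volume volume := e.measurePreserving
  have hbound : ∀ x, ‖φ x‖ₑ ≤ ∫⁻ y, ‖fderiv ℝ φ y‖ₑ := by
    intro x
    have h1 : ContDiff ℝ 1 (φ ∘ e) := hφ.comp e.contDiff
    have h2 : HasCompactSupport (φ ∘ e) := hc.comp_homeomorph e.toHomeomorph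
    calc ‖φ x‖ₑ = ‖(φ ∘ e) (e.symm x)‖ₑ := by simp
      _ ≤ ∫⁻ t in Iic (e.symm x), ‖deriv (φ ∘ e) t‖ₑ :=
        h2.enorm_le_lintegral_Ici_deriv h1 _
      _ ≤ ∫⁻ t, ‖deriv (φ ∘ e) t‖ₑ := setLIntegral_le_lintegral _ _
      _ ≤ ∫⁻ t, ‖fderiv ℝ φ (e t)‖ₑ := by
        refine lintegral_mono fun t => ?_
        have hd : HasDerivAt (φ ∘ e) (fderiv ℝ φ (e t) (e 1)) t :=
          ((hφ.differentiable one_ne_zero) (e t)).hasFDerivAt.comp_hasDerivAt t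
            (e.toContinuousLinearEquiv.toContinuousLinearMap.hasDerivAt (x := t))
        rw [hd.deriv]
        have h3 := (fderiv ℝ φ (e t)).le_opNorm (e 1)
        rw [e.norm_map, norm_one, mul_one] at h3
        exact enorm_le_iff_norm_le.2 h3
      _ = ∫⁻ y, ‖fderiv ℝ φ y‖ₑ :=
        he.lintegral_comp (hφ.continuous_fderiv one_ne_zero).enorm.measurable
  rw [eLpNorm_exponent_top, eLpNorm_one_eq_lintegral_enorm]
  exact essSup_le_of_ae_le _ (Eventually.of_forall hbound)

/-- In dimension `N ≥ 2`, below the critical exponent there is an admissible exponent for the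
Gagliardo-Nirenberg-Sobolev inequality. -/
lemma exists_sobolev_exponent (hN : 2 ≤ N) (hp : 1 < p) {m : ℝ} (hm : 1 ≤ m)
    (hcrit : (m : EReal) < criticalExponent N p) :
    ∃ a : ℝ, 1 ≤ a ∧ a ≤ p ∧ a < N ∧ a⁻¹ - (N : ℝ)⁻¹ ≤ m⁻¹ := by
  have hN' : (2 : ℝ) ≤ N := by exact_mod_cast hN
  unfold criticalExponent at hcrit
  split_ifs at hcrit with hpN
  · refine ⟨p, hp.le, le_rfl, hpN, ?_⟩
    have h1 : m < p * N / (N - p) := by exact_mod_cast hcrit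
    have h2 : p⁻¹ - (N : ℝ)⁻¹ = (p * N / (N - p))⁻¹ := by
      have : (N : ℝ) - p ≠ 0 := by linarith
      field_simp
    rw [h2]
    exact inv_anti₀ (by linarith) h1.le
  · have hm0 : 0 < m⁻¹ := by positivity
    have hN0 : 0 < (N : ℝ)⁻¹ := by positivity
    have hlt : ((N : ℝ)⁻¹ + m⁻¹)⁻¹ < N := by
      rw [inv_lt_comm₀ (by positivity) (by positivity)]
      linarith
    -- The second entry solves `a⁻¹ - N⁻¹ = m⁻¹`. Raising it to at least `1` only decreases `a⁻¹`,
    -- and `N ≥ 2` keeps the maximum below `N ≤ p`.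
    refine ⟨max 1 ((N : ℝ)⁻¹ + m⁻¹)⁻¹, le_max_left _ _, max_le hp.le (by linarith),
      max_lt (by linarith) hlt, ?_⟩
    have : (max 1 ((N : ℝ)⁻¹ + m⁻¹)⁻¹)⁻¹ ≤ (N : ℝ)⁻¹ + m⁻¹ := by
      rw [inv_le_comm₀ (by positivity) (by positivity)]
      exact le_max_right _ _
    linarith

/-- The subcritical Sobolev inequality for test functions on a bounded set. -/
lemma exists_eLpNorm_le_eLpNorm_fderiv (hN : 1 ≤ N) (hΩ_bdd : Bornology.IsBounded Ω)
    (hp : 1 < p) {m : ℝ} (hm : 1 ≤ m) (hcrit : (m : EReal) < criticalExponent N p) :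
    ∃ C : ℝ≥0, ∀ φ : Eucl N → ℝ, IsTestFunction Ω φ →
      eLpNorm φ (ENNReal.ofReal m) (volume.restrict Ω) ≤
        C * eLpNorm (fderiv ℝ φ) (ENNReal.ofReal p) (volume.restrict Ω) := by
  have : IsFiniteMeasure (volume.restrict Ω) := ⟨by simpa using hΩ_bdd.measure_lt_top⟩
  have hm1 : 1 ≤ ENNReal.ofReal m := by simpa using hm
  rcases hN.eq_or_lt with rfl | hN2
  · obtain ⟨C₁, h₁⟩ := exists_eLpNorm_le_of_exponent_le (F := ℝ) (μ := volume.restrict Ω)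
      hm1 (le_top (a := ENNReal.ofReal m))
    obtain ⟨C₂, h₂⟩ := exists_eLpNorm_le_of_exponent_le (F := Eucl 1 →L[ℝ] ℝ)
      (μ := volume.restrict Ω) (le_refl 1) (b := ENNReal.ofReal p) (by simpa using hp.le)
    refine ⟨C₁ * C₂, fun φ hφ => ?_⟩
    calc _ ≤ C₁ * eLpNorm φ ⊤ (volume.restrict Ω) :=
          h₁ φ hφ.smooth.continuous.aestronglyMeasurable
      _ ≤ C₁ * eLpNorm (fderiv ℝ φ) 1 (volume.restrict Ω) := by
          rw [eLpNorm_restrict_eq_of_support_subset hφ.support_subset,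
            hφ.eLpNorm_fderiv_restrict]
          gcongr
          exact eLpNorm_top_le_eLpNorm_fderiv_one (hφ.smooth.of_le (by simp)) hφ.compact
      _ ≤ C₁ * (C₂ * eLpNorm (fderiv ℝ φ) (ENNReal.ofReal p) (volume.restrict Ω)) := by
          gcongr
          exact h₂ _ (hφ.aestronglyMeasurable_fderiv _)
      _ = _ := by rw [ENNReal.coe_mul, mul_assoc]
  · obtain ⟨a, ha1, hap, haN, ham⟩ := exists_sobolev_exponent hN2 hp hm hcrit
    obtain ⟨C₂, h₂⟩ := exists_eLpNorm_le_of_exponent_le (F := Eucl N →L[ℝ] ℝ)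
      (μ := volume.restrict Ω) (a := ENNReal.ofReal a) (b := ENNReal.ofReal p)
      (by simpa using ha1) (ENNReal.ofReal_le_ofReal hap)
    refine ⟨eLpNormLESNormFDerivOfLeConst ℝ volume Ω a.toNNReal m.toNNReal * C₂, fun φ hφ => ?_⟩
    have hsob := eLpNorm_le_eLpNorm_fderiv_of_le (μ := volume) (u := φ) (s := Ω)
      (p := a.toNNReal) (q := m.toNNReal)
      (hφ.smooth.of_le (by simp)) hφ.support_subset (by simpa using ha1)
      (by rw [finrank_euclideanSpace_fin, ← NNReal.coe_lt_coe, Real.coe_toNNReal _ (by linarith)]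
          simpa using haN)
      (by rw [finrank_euclideanSpace_fin, Real.coe_toNNReal _ (by linarith), NNReal.coe_inv,
            Real.coe_toNNReal _ (by linarith)]
          exact ham) hΩ_bdd
    rw [eLpNorm_restrict_eq_of_support_subset hφ.support_subset, ENNReal.coe_mul, mul_assoc]
    refine hsob.trans ?_
    gcongr
    rw [← hφ.eLpNorm_fderiv_restrict]
    exact h₂ _ (hφ.aestronglyMeasurable_fderiv _)

/-- A bound by the gradient passes from the test functions to `W_0^{1,p}(Ω)`. -/
lemma eLpNorm_fn_le_of_test [Fact (1 < p)] {m : ℝ≥0∞} {C : ℝ≥0}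
    (hC : ∀ φ : Eucl N → ℝ, IsTestFunction Ω φ → eLpNorm φ m (volume.restrict Ω) ≤
        C * eLpNorm (fderiv ℝ φ) (ENNReal.ofReal p) (volume.restrict Ω)) (u : W01p Ω p) :
    eLpNorm (fn u) m (volume.restrict Ω) ≤
      C * eLpNorm (grad u) (ENNReal.ofReal p) (volume.restrict Ω) := by
  obtain ⟨w, hw, hlim⟩ := mem_closure_iff_seq_limit.1
    (show u.1 ∈ closure (testPairs Ω p : Set (LpPair Ω p)) from u.2.2)
  have hbound : ∀ n, eLpNorm (w n).1 m (volume.restrict Ω) ≤ C * ENNReal.ofReal ‖(w n).2‖ := by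
    intro n
    obtain ⟨φ, hφ, h1, h2⟩ := hw n
    rw [eLpNorm_congr_ae h1, Lp.norm_def, ENNReal.ofReal_toReal (Lp.eLpNorm_ne_top _),
      eLpNorm_congr_ae h2,
      eLpNorm_congr_norm_ae (Eventually.of_forall (norm_gradient_eq_norm_fderiv φ))]
    exact hC φ hφ
  have hlim1 : Tendsto (fun n => (w n).1) atTop (𝓝 u.1.1) := hlim.fst_nhds
  have hlim2 : Tendsto (fun n => ‖(w n).2‖) atTop (𝓝 ‖u.1.2‖) := hlim.snd_nhds.norm
  -- The norm is lower semicontinuous under convergence in measure. The slack `ε` turns convergence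
  -- of the gradient norms into one bound valid for all large `n`.
  have hε : ∀ ε > (0 : ℝ), eLpNorm (fn u) m (volume.restrict Ω) ≤
      C * ENNReal.ofReal (‖u.1.2‖ + ε) := by
    intro ε hε
    refine eLpNorm_le_of_tendstoInMeasure ?_ (tendstoInMeasure_of_tendsto_Lp hlim1)
      (fun n => Lp.aestronglyMeasurable _)
    filter_upwards [hlim2.eventually_lt_const (show ‖u.1.2‖ < ‖u.1.2‖ + ε by linarith)] with n hn
    refine (hbound n).trans ?_
    gcongr
  have hgrad : eLpNorm (grad u) (ENNReal.ofReal p) (volume.restrict Ω) =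
      ENNReal.ofReal ‖u.1.2‖ := by
    rw [Lp.norm_def, ENNReal.ofReal_toReal (Lp.eLpNorm_ne_top _)]
    rfl
  rw [hgrad]
  have hcont : Tendsto (fun ε : ℝ => (C : ℝ≥0∞) * ENNReal.ofReal (‖u.1.2‖ + ε)) (𝓝[>] 0)
      (𝓝 (C * ENNReal.ofReal ‖u.1.2‖)) := by
    refine ENNReal.Tendsto.const_mul (ENNReal.tendsto_ofReal ?_) (Or.inr ENNReal.coe_ne_top)
    have : Tendsto (fun ε : ℝ => ‖u.1.2‖ + ε) (𝓝 0) (𝓝 (‖u.1.2‖ + 0)) :=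
      (continuous_const.add continuous_id).tendsto 0
    rw [add_zero] at this
    exact this.mono_left nhdsWithin_le_nhds
  exact ge_of_tendsto hcont (eventually_mem_nhdsWithin.mono fun ε h => hε ε h)

end Sobolev

/-! ### Integral form of the Sobolev inequality and definiteness of the gradient norm. -/

section Nehari

variable {N : ℕ} {Ω : Set (Eucl N)} {p : ℝ} [hp : Fact (1 < p)]

/-- The Sobolev inequality on `W_0^{1,p}(Ω)` in integral form. -/
lemma exists_integral_rpow_le (hN : 1 ≤ N) (hΩ_bdd : Bornology.IsBounded Ω) {a : ℝ} (ha : 1 ≤ a)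
    (hcrit : (a : EReal) < criticalExponent N p) :
    ∃ K : ℝ, 0 < K ∧ ∀ u : W01p Ω p, IntegrableOn (fun x => |fn u x| ^ a) Ω ∧
      ∫ x in Ω, |fn u x| ^ a ≤ K * (∫ x in Ω, ‖grad u x‖ ^ p) ^ (a / p) := by
  obtain ⟨C, hC⟩ := exists_eLpNorm_le_eLpNorm_fderiv hN hΩ_bdd hp.out ha hcrit
  have hp0 : 0 < p := zero_lt_one.trans hp.out
  have ha0 : 0 < a := zero_lt_one.trans_le ha
  -- Adding `1` makes the constant strictly positive even if `C = 0`.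
  refine ⟨((C : ℝ) + 1) ^ a, by positivity, fun u => ?_⟩
  have hle := eLpNorm_fn_le_of_test hC u
  have hG : MemLp (grad u) (ENNReal.ofReal p) (volume.restrict Ω) := Lp.memLp _
  have hmem : MemLp (fn u) (ENNReal.ofReal a) (volume.restrict Ω) :=
    ⟨Lp.aestronglyMeasurable _, hle.trans_lt (ENNReal.mul_lt_top ENNReal.coe_lt_top hG.2)⟩
  have ha1 : ENNReal.ofReal a ≠ 0 := by simpa using ha0
  have hp1 : ENNReal.ofReal p ≠ 0 := by simpa using hp0
  constructor
  · have := hmem.integrable_norm_rpow ha1 ENNReal.ofReal_ne_top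
    rwa [ENNReal.toReal_ofReal ha0.le] at this
  · rw [hmem.eLpNorm_eq_integral_rpow_norm ha1 ENNReal.ofReal_ne_top,
      hG.eLpNorm_eq_integral_rpow_norm hp1 ENNReal.ofReal_ne_top,
      ENNReal.toReal_ofReal ha0.le, ENNReal.toReal_ofReal hp0.le] at hle
    have hu0 : 0 ≤ ∫ x in Ω, ‖fn u x‖ ^ a := integral_nonneg fun x => by positivity
    have hg0 : 0 ≤ ∫ x in Ω, ‖grad u x‖ ^ p := integral_nonneg fun x => by positivity
    have hreal : (∫ x in Ω, ‖fn u x‖ ^ a) ^ a⁻¹ ≤ C * (∫ x in Ω, ‖grad u x‖ ^ p) ^ p⁻¹ := by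
      rw [← ENNReal.ofReal_coe_nnreal, ← ENNReal.ofReal_mul C.coe_nonneg] at hle
      exact (ENNReal.ofReal_le_ofReal_iff (by positivity)).1 hle
    calc ∫ x in Ω, |fn u x| ^ a = ((∫ x in Ω, ‖fn u x‖ ^ a) ^ a⁻¹) ^ a := by
          rw [Real.rpow_inv_rpow hu0 ha0.ne']
          rfl
      _ ≤ (((C : ℝ) + 1) * (∫ x in Ω, ‖grad u x‖ ^ p) ^ p⁻¹) ^ a := by
          gcongr
          refine hreal.trans ?_
          gcongr
          linarith
      _ = _ := by
          rw [Real.mul_rpow (by positivity) (by positivity), ← Real.rpow_mul hg0, inv_mul_eq_div]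

lemma grad_integral_nonneg (u : W01p Ω p) : 0 ≤ ∫ x in Ω, ‖grad u x‖ ^ p :=
  integral_nonneg fun x => by positivity

/-- An element of `W_0^{1,p}(Ω)` whose gradient vanishes is zero. -/
lemma eq_zero_of_integral_grad_eq_zero (hN : 1 ≤ N) (hΩ_bdd : Bornology.IsBounded Ω) {a : ℝ}
    (ha : 1 ≤ a) (hcrit : (a : EReal) < criticalExponent N p) {u : W01p Ω p}
    (hu : ∫ x in Ω, ‖grad u x‖ ^ p = 0) : u = 0 := by
  have hp0 : 0 < p := zero_lt_one.trans hp.out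
  have ha0 : 0 < a := zero_lt_one.trans_le ha
  obtain ⟨K, -, hK⟩ := exists_integral_rpow_le hN hΩ_bdd ha hcrit
  obtain ⟨hint, hle⟩ := hK u
  rw [hu, Real.zero_rpow (by positivity), mul_zero] at hle
  have hG : MemLp (grad u) (ENNReal.ofReal p) (volume.restrict Ω) := Lp.memLp _
  have hGint := hG.integrable_norm_rpow (by simpa using hp0) ENNReal.ofReal_ne_top
  rw [ENNReal.toReal_ofReal hp0.le] at hGint
  have h1 := (integral_eq_zero_iff_of_nonneg (fun x => by positivity) hGint).1 hu
  have h2 := (integral_eq_zero_iff_of_nonneg (fun x => by positivity) hint).1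
    (hle.antisymm (integral_nonneg fun x => by positivity))
  refine Subtype.ext (Prod.ext (Lp.ext ?_) (Lp.ext ?_))
  · filter_upwards [h2, Lp.coeFn_zero ℝ (ENNReal.ofReal p) (volume.restrict Ω)] with x hx h0
    have : fn u x = 0 := by
      simpa [Real.rpow_eq_zero_iff_of_nonneg, ha0.ne'] using hx
    exact this.trans h0.symm
  · filter_upwards [h1, Lp.coeFn_zero (Eucl N) (ENNReal.ofReal p) (volume.restrict Ω)]
      with x hx h0
    have : grad u x = 0 := by
      simpa [Real.rpow_eq_zero_iff_of_nonneg, hp0.ne'] using hx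
    exact this.trans h0.symm

/-! ### Homogeneity along rays and radial derivatives. -/

lemma fn_smul (t : ℝ) (u : W01p Ω p) : fn (t • u) =ᵐ[volume.restrict Ω] fun x => t * fn u x :=
  Lp.coeFn_smul t u.1.1

lemma grad_smul (t : ℝ) (u : W01p Ω p) :
    grad (t • u) =ᵐ[volume.restrict Ω] fun x => t • grad u x :=
  Lp.coeFn_smul t u.1.2

lemma integral_grad_smul {t : ℝ} (ht : 0 < t) (u : W01p Ω p) :
    ∫ x in Ω, ‖grad (t • u) x‖ ^ p = t ^ p * ∫ x in Ω, ‖grad u x‖ ^ p := by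
  rw [← integral_const_mul]
  refine integral_congr_ae ?_
  filter_upwards [grad_smul t u] with x hx
  rw [hx, norm_smul, Real.norm_of_nonneg ht.le, Real.mul_rpow ht.le (norm_nonneg _)]

lemma integral_weight_smul {t : ℝ} (ht : 0 < t) (q : ℝ) (f : Eucl N → ℝ) (u : W01p Ω p) :
    ∫ x in Ω, f x * |fn (t • u) x| ^ q = t ^ q * ∫ x in Ω, f x * |fn u x| ^ q := by
  rw [← integral_const_mul]
  refine integral_congr_ae ?_
  filter_upwards [fn_smul t u] with x hx
  rw [hx, abs_mul, abs_of_pos ht, Real.mul_rpow ht.le (abs_nonneg _)]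
  ring

lemma integral_coupling_smul {t : ℝ} (ht : 0 < t) (r s : ℝ) (h : Eucl N → ℝ) (u v : W01p Ω p) :
    ∫ x in Ω, h x * |fn (t • u) x| ^ r * |fn (t • v) x| ^ s =
      t ^ (r + s) * ∫ x in Ω, h x * |fn u x| ^ r * |fn v x| ^ s := by
  rw [← integral_const_mul]
  refine integral_congr_ae ?_
  filter_upwards [fn_smul t u, fn_smul t v] with x hx hy
  rw [hx, hy, abs_mul, abs_mul, abs_of_pos ht, Real.mul_rpow ht.le (abs_nonneg _),
    Real.mul_rpow ht.le (abs_nonneg _), Real.rpow_add ht]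
  ring

lemma normW_rpow (w : W Ω p) :
    normW w ^ p = (∫ x in Ω, ‖grad w.1 x‖ ^ p) + ∫ x in Ω, ‖grad w.2 x‖ ^ p := by
  rw [normW, one_div, Real.rpow_inv_rpow (add_nonneg (grad_integral_nonneg _)
    (grad_integral_nonneg _)) (zero_lt_one.trans hp.out).ne']

/-- The part of the energy that is homogeneous of degree `q`. -/
def concavePart (q : ℝ) (f g : Eucl N → ℝ) (lam mu : ℝ) (w : W Ω p) : ℝ :=
  lam * (∫ x in Ω, f x * |fn w.1 x| ^ q) + mu * ∫ x in Ω, g x * |fn w.2 x| ^ q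

/-- The part of the energy that is homogeneous of degree `r + s`. -/
def couplingPart (r s : ℝ) (h : Eucl N → ℝ) (w : W Ω p) : ℝ :=
  ∫ x in Ω, h x * |fn w.1 x| ^ r * |fn w.2 x| ^ s

lemma normW_rpow_smul {t : ℝ} (ht : 0 < t) (w : W Ω p) :
    normW (t • w) ^ p = t ^ p * normW w ^ p := by
  rw [normW_rpow, normW_rpow, Prod.smul_fst, Prod.smul_snd, integral_grad_smul ht,
    integral_grad_smul ht, mul_add]

lemma concavePart_smul {t : ℝ} (ht : 0 < t) (q : ℝ) (f g : Eucl N → ℝ) (lam mu : ℝ) (w : W Ω p) :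
    concavePart q f g lam mu (t • w) = t ^ q * concavePart q f g lam mu w := by
  rw [concavePart, concavePart, Prod.smul_fst, Prod.smul_snd, integral_weight_smul ht,
    integral_weight_smul ht]
  ring

lemma couplingPart_smul {t : ℝ} (ht : 0 < t) (r s : ℝ) (h : Eucl N → ℝ) (w : W Ω p) :
    couplingPart r s h (t • w) = t ^ (r + s) * couplingPart r s h w :=
  integral_coupling_smul ht r s h w.1 w.2

/-- The derivative, in the radial direction, of a functional that is a combination of three powers
along a ray. -/
lemma pairing_self_of_smul {F : W Ω p → ℝ} {w : W Ω p} {a b c α β γ : ℝ}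
    (hF : ∀ t : ℝ, 0 < t → F (t • w) = a * t ^ α + b * t ^ β + c * t ^ γ) :
    pairing F w w = a * α + b * β + c * γ := by
  have hpow : ∀ e : ℝ, HasDerivAt (fun t : ℝ => (1 + t) ^ e) e 0 := fun e => by
    simpa using ((hasDerivAt_id (0 : ℝ)).const_add 1).rpow_const (p := e) (Or.inl (by simp))
  have hd := (((hpow α).const_mul a).add ((hpow β).const_mul b)).add ((hpow γ).const_mul c)
  refine HasDerivAt.deriv (hd.congr_of_eventuallyEq ?_)
  -- The derivative at `t = 0` only sees `t > -1`, where the scaling factor `1 + t` is positive.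
  filter_upwards [Ioi_mem_nhds (show (-1 : ℝ) < 0 by norm_num)] with t ht
  rw [show w + t • w = (1 + t) • w by rw [add_smul, one_smul],
    hF _ (by linarith [show -1 < t from ht])]
  rfl

/-- Differentiating along the ray brings down the exponents `p`, `q`, `r + s`, which cancel the
coefficients of the energy. The result is again a sum of homogeneous terms, so the same computation
applies to `psi` itself. -/
lemma psi_eq {q r s : ℝ} (hq : q ≠ 0) (hrs : r + s ≠ 0) (f g h : Eucl N → ℝ) (lam mu : ℝ)
    (w : W Ω p) :
    psi q r s f g h lam mu w =
      normW w ^ p - concavePart q f g lam mu w - couplingPart r s h w := by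
  have hp0 : p ≠ 0 := (zero_lt_one.trans hp.out).ne'
  rw [psi, pairing_self_of_smul (a := 1 / p * normW w ^ p) (α := p)
    (b := -(1 / q * concavePart q f g lam mu w)) (β := q)
    (c := -(1 / (r + s) * couplingPart r s h w)) (γ := r + s)]
  · field_simp
    ring
  · intro t ht
    have : energy q r s f g h lam mu (t • w) = 1 / p * normW (t • w) ^ p
        - 1 / q * concavePart q f g lam mu (t • w)
        - 1 / (r + s) * couplingPart r s h (t • w) := rfl
    rw [this, normW_rpow_smul ht, concavePart_smul ht, couplingPart_smul ht]
    ring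

lemma pairing_psi_self {q r s : ℝ} (hq : q ≠ 0) (hrs : r + s ≠ 0) (f g h : Eucl N → ℝ)
    (lam mu : ℝ) (w : W Ω p) :
    pairing (psi q r s f g h lam mu) w w =
      p * normW w ^ p - q * concavePart q f g lam mu w - (r + s) * couplingPart r s h w := by
  rw [pairing_self_of_smul (a := normW w ^ p) (α := p) (b := -concavePart q f g lam mu w) (β := q)
    (c := -couplingPart r s h w) (γ := r + s)]
  · ring
  · intro t ht
    rw [psi_eq hq hrs, normW_rpow_smul ht, concavePart_smul ht, couplingPart_smul ht]
    ring

/-! ### Positivity of the norm and bounds for the lower-order terms. -/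

lemma normW_rpow_pos (hN : 1 ≤ N) (hΩ_bdd : Bornology.IsBounded Ω) {a : ℝ}
    (ha : 1 ≤ a) (hcrit : (a : EReal) < criticalExponent N p) {w : W Ω p} (hw : w ≠ 0) :
    0 < normW w ^ p := by
  have h1 := grad_integral_nonneg w.1
  have h2 := grad_integral_nonneg w.2
  rw [normW_rpow]
  refine (add_nonneg h1 h2).lt_of_ne' fun h0 => hw (Prod.ext ?_ ?_)
  · exact eq_zero_of_integral_grad_eq_zero hN hΩ_bdd ha hcrit (by linarith)
  · exact eq_zero_of_integral_grad_eq_zero hN hΩ_bdd ha hcrit (by linarith)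

lemma IsSignChangingWeight.exists_bound {f : Eucl N → ℝ} (hf : IsSignChangingWeight Ω f)
    (hΩ_bdd : Bornology.IsBounded Ω) : ∃ M : ℝ, 0 < M ∧ ∀ x ∈ Ω, |f x| ≤ M := by
  obtain ⟨M, hM⟩ := hΩ_bdd.isCompact_closure.exists_bound_of_continuousOn hf.continuousOn
  exact ⟨max M 1, by positivity, fun x hx => (hM x (subset_closure hx)).trans (le_max_left _ _)⟩

lemma exists_integral_rpow_le_normW (hN : 1 ≤ N) (hΩ_bdd : Bornology.IsBounded Ω) {a : ℝ}
    (ha : 1 ≤ a) (hcrit : (a : EReal) < criticalExponent N p) :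
    ∃ K : ℝ, 0 < K ∧ ∀ w : W Ω p,
      (IntegrableOn (fun x => |fn w.1 x| ^ a) Ω ∧ IntegrableOn (fun x => |fn w.2 x| ^ a) Ω) ∧
      ∫ x in Ω, |fn w.1 x| ^ a ≤ K * (normW w ^ p) ^ (a / p) ∧
      ∫ x in Ω, |fn w.2 x| ^ a ≤ K * (normW w ^ p) ^ (a / p) := by
  obtain ⟨K, hK0, hK⟩ := exists_integral_rpow_le (p := p) hN hΩ_bdd ha hcrit
  have hp0 : 0 < p := zero_lt_one.trans hp.out
  refine ⟨K, hK0, fun w => ⟨⟨(hK w.1).1, (hK w.2).1⟩, ?_, ?_⟩⟩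
  all_goals
    have h1 := grad_integral_nonneg w.1
    have h2 := grad_integral_nonneg w.2
    rw [normW_rpow]
  · refine (hK w.1).2.trans ?_
    gcongr
    linarith
  · refine (hK w.2).2.trans ?_
    gcongr
    linarith

lemma abs_integral_weight_le (hΩ : MeasurableSet Ω) {f F : Eucl N → ℝ} {M : ℝ}
    (hM : ∀ x ∈ Ω, |f x| ≤ M) (hF : IntegrableOn F Ω) (hF0 : ∀ x, 0 ≤ F x) :
    |∫ x in Ω, f x * F x| ≤ M * ∫ x in Ω, F x := by
  rw [← integral_const_mul, ← Real.norm_eq_abs]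
  refine norm_integral_le_of_norm_le (hF.const_mul M) ?_
  filter_upwards [ae_restrict_mem hΩ] with x hx
  rw [Real.norm_eq_abs, abs_mul, abs_of_nonneg (hF0 x)]
  exact mul_le_mul_of_nonneg_right (hM x hx) (hF0 x)

/-- The weights are bounded on the compact closure of `Ω`, and their signs play no role. What
matters is that `K` does not depend on `lam` or `mu`. -/
lemma exists_concavePart_le (hN : 1 ≤ N) (hΩ : MeasurableSet Ω) (hΩ_bdd : Bornology.IsBounded Ω)
    {q : ℝ} (hq : 1 ≤ q) (hcrit : (q : EReal) < criticalExponent N p) {f g : Eucl N → ℝ}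
    (hf : IsSignChangingWeight Ω f) (hg : IsSignChangingWeight Ω g) :
    ∃ K : ℝ, 0 < K ∧ ∀ (lam mu : ℝ) (w : W Ω p),
      concavePart q f g lam mu w ≤ (|lam| + |mu|) * K * (normW w ^ p) ^ (q / p) := by
  obtain ⟨K, hK0, hK⟩ := exists_integral_rpow_le_normW (p := p) hN hΩ_bdd hq hcrit
  obtain ⟨M₁, hM₁, hf'⟩ := hf.exists_bound hΩ_bdd
  obtain ⟨M₂, hM₂, hg'⟩ := hg.exists_bound hΩ_bdd
  refine ⟨(M₁ + M₂) * K, by positivity, fun lam mu w => ?_⟩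
  obtain ⟨⟨hi1, hi2⟩, hu, hv⟩ := hK w
  set E := K * (normW w ^ p) ^ (q / p) with hE
  have hE0 : 0 ≤ E := (integral_nonneg fun x => by positivity).trans hu
  have h1 := (abs_integral_weight_le hΩ hf' hi1 fun x => by positivity).trans
    (mul_le_mul_of_nonneg_left hu hM₁.le)
  have h2 := (abs_integral_weight_le hΩ hg' hi2 fun x => by positivity).trans
    (mul_le_mul_of_nonneg_left hv hM₂.le)
  calc concavePart q f g lam mu w
      ≤ |lam| * (M₁ * E) + |mu| * (M₂ * E) := by
        refine add_le_add ((le_abs_self _).trans ?_) ((le_abs_self _).trans ?_)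
        · rw [abs_mul]
          gcongr
        · rw [abs_mul]
          gcongr
    _ ≤ |lam| * ((M₁ + M₂) * E) + |mu| * ((M₁ + M₂) * E) := by
        gcongr <;> linarith
    _ = _ := by rw [hE]; ring

/-- Replace the smaller base by the larger one. This decouples `u` and `v`, so that Sobolev is
needed only at the exponent `r + s`. -/
lemma rpow_mul_rpow_le_add {a b r s : ℝ} (ha : 0 ≤ a) (hb : 0 ≤ b) (hr : 0 < r) (hs : 0 < s) :
    a ^ r * b ^ s ≤ a ^ (r + s) + b ^ (r + s) := by
  rw [Real.rpow_add_of_nonneg ha hr.le hs.le, Real.rpow_add_of_nonneg hb hr.le hs.le]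
  rcases le_total a b with h | h
  · have : a ^ r ≤ b ^ r := by gcongr
    have : a ^ r * b ^ s ≤ b ^ r * b ^ s := by gcongr
    have : 0 ≤ a ^ r * a ^ s := by positivity
    linarith
  · have : b ^ s ≤ a ^ s := by gcongr
    have : a ^ r * b ^ s ≤ a ^ r * a ^ s := by gcongr
    have : 0 ≤ b ^ r * b ^ s := by positivity
    linarith

lemma exists_couplingPart_le (hN : 1 ≤ N) (hΩ : MeasurableSet Ω) (hΩ_bdd : Bornology.IsBounded Ω)
    {r s : ℝ} (hr : 1 ≤ r) (hs : 1 ≤ s)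
    (hcrit : ((r + s : ℝ) : EReal) < criticalExponent N p) {h : Eucl N → ℝ}
    (hh : IsSignChangingWeight Ω h) :
    ∃ K : ℝ, 0 < K ∧ ∀ w : W Ω p,
      couplingPart r s h w ≤ K * (normW w ^ p) ^ ((r + s) / p) := by
  obtain ⟨K, hK0, hK⟩ := exists_integral_rpow_le_normW (p := p) hN hΩ_bdd
    (show 1 ≤ r + s by linarith) hcrit
  obtain ⟨M, hM, hh'⟩ := hh.exists_bound hΩ_bdd
  refine ⟨2 * M * K, by positivity, fun w => ?_⟩
  obtain ⟨⟨hi1, hi2⟩, hu, hv⟩ := hK w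
  have hsum : couplingPart r s h w ≤
      ∫ x in Ω, M * (|fn w.1 x| ^ (r + s) + |fn w.2 x| ^ (r + s)) := by
    have hint : IntegrableOn (fun x => M * (|fn w.1 x| ^ (r + s) + |fn w.2 x| ^ (r + s))) Ω :=
      (hi1.add hi2).const_mul M
    refine (Real.le_norm_self _).trans (norm_integral_le_of_norm_le hint ?_)
    filter_upwards [ae_restrict_mem hΩ] with x hx
    rw [Real.norm_eq_abs, mul_assoc, abs_mul,
      abs_of_nonneg (show 0 ≤ |fn w.1 x| ^ r * |fn w.2 x| ^ s by positivity)]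
    exact mul_le_mul (hh' x hx) (rpow_mul_rpow_le_add (abs_nonneg _) (abs_nonneg _)
      (by linarith) (by linarith)) (by positivity) hM.le
  rw [integral_const_mul, integral_add hi1 hi2] at hsum
  calc _ ≤ _ := hsum
    _ ≤ M * (K * (normW w ^ p) ^ ((r + s) / p) + K * (normW w ^ p) ^ ((r + s) / p)) := by
        gcongr
    _ = _ := by ring

/-- Since `m > p`, the inequality `A ≤ K₁ * A ^ (m / p)` keeps `A` away from zero. Since `q < p`,
the power `A ^ (1 - q / p)` is then bounded below too, and it dominates `ε * K₂` for small `ε`. -/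
lemma exists_pos_forall_lt_rpow {p q m K₁ K₂ : ℝ} (hp : 0 < p) (hqp : q < p) (hpm : p < m)
    (hK₁ : 0 < K₁) (hK₂ : 0 < K₂) :
    ∃ δ > 0, ∀ A ε : ℝ, 0 < A → ε < δ → A ≤ K₁ * A ^ (m / p) → ε * K₂ * A ^ (q / p) < A := by
  have he : 0 < m / p - 1 := by rw [sub_pos, one_lt_div hp]; exact hpm
  have hd : 0 < 1 - q / p := by rw [sub_pos, div_lt_one hp]; exact hqp
  -- The inner power `K₁⁻¹ ^ (m / p - 1)⁻¹` is the lower bound for `A`.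
  refine ⟨(K₁⁻¹ ^ (m / p - 1)⁻¹) ^ (1 - q / p) / K₂, by positivity, fun A ε hA hε hle => ?_⟩
  have h1 : K₁⁻¹ ≤ A ^ (m / p - 1) := by
    rw [Real.rpow_sub_one hA.ne', inv_le_iff_one_le_mul₀ hK₁, ← mul_div_right_comm,
      one_le_div hA, mul_comm]
    exact hle
  have h2 : K₁⁻¹ ^ (m / p - 1)⁻¹ ≤ A := by
    rw [Real.rpow_inv_le_iff_of_pos (by positivity) hA.le he]
    exact h1
  have h3 : ε * K₂ < A ^ (1 - q / p) := by
    rw [lt_div_iff₀ hK₂] at hε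
    exact hε.trans_le (by gcongr)
  calc ε * K₂ * A ^ (q / p) < A ^ (1 - q / p) * A ^ (q / p) := by gcongr
    _ = A := by rw [← Real.rpow_add hA, sub_add_cancel, Real.rpow_one]

end Nehari

end NehariSystem

end
-- Absence of degenerate Nehari points.
theorem lemma2p4 {N : ℕ} (hN : 1 ≤ N) (Ω : Set (NehariSystem.Eucl N)) (hΩ_open : IsOpen Ω)
    (hΩ_conn : IsConnected Ω) (hΩ_bdd : Bornology.IsBounded Ω)
    (p q r s : ℝ) [Fact (1 < p)] (hq : 1 < q) (hqp : q < p) (hr : p < r) (hs : p < s)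
    (hrs : ((r + s : ℝ) : EReal) < NehariSystem.criticalExponent N p)
    (f g h : NehariSystem.Eucl N → ℝ)
    (hf : NehariSystem.IsSignChangingWeight Ω f)
    (hg : NehariSystem.IsSignChangingWeight Ω g)
    (hh : NehariSystem.IsSignChangingWeight Ω h) :
    ∃ lam₀ > (0 : ℝ), ∃ mu₀ > (0 : ℝ), ∀ lam mu : ℝ,
      0 < |lam| → |lam| < lam₀ → 0 < |mu| → |mu| < mu₀ →
        NehariSystem.nehariZero Ω p q r s f g h lam mu = ∅ := by
  have hqcrit : (q : EReal) < NehariSystem.criticalExponent N p :=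
    lt_trans (by exact_mod_cast (by linarith : q < r + s)) hrs
  obtain ⟨B, hB0, hB⟩ := NehariSystem.exists_concavePart_le (p := p) hN hΩ_open.measurableSet
    hΩ_bdd hq.le hqcrit hf hg
  obtain ⟨H, hH0, hH⟩ := NehariSystem.exists_couplingPart_le (p := p) hN hΩ_open.measurableSet
    hΩ_bdd (show 1 ≤ r by linarith) (show 1 ≤ s by linarith) hrs hh
  have hpq : 0 < p - q := by linarith
  have hmq : 0 < r + s - q := by linarith
  have hmp : 0 < r + s - p := by linarith
  obtain ⟨δ, hδ, hA⟩ := NehariSystem.exists_pos_forall_lt_rpow (p := p) (q := q) (m := r + s)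
    (K₁ := (r + s - q) / (p - q) * H) (K₂ := (r + s - q) / (r + s - p) * B)
    (by linarith) hqp (by linarith) (by positivity) (by positivity)
  -- Only the sum `|lam| + |mu|` enters the estimates, and it must stay below `δ`.
  refine ⟨δ / 2, by positivity, δ / 2, by positivity, fun lam mu _ hlam _ hmu => ?_⟩
  refine Set.eq_empty_of_forall_notMem ?_
  rintro w ⟨⟨hw, h1⟩, h2⟩
  have hpos := NehariSystem.normW_rpow_pos hN hΩ_bdd hq.le hqcrit hw
  change NehariSystem.psi q r s f g h lam mu w = 0 at h1
  rw [NehariSystem.psi_eq (by linarith) (by linarith)] at h1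
  rw [NehariSystem.pairing_psi_self (by linarith) (by linarith)] at h2
  -- Eliminating the concave part gives the lower bound on the norm; eliminating the coupling part,
  -- in `e2`, gives the conflicting upper bound.
  have e1 : NehariSystem.normW w ^ p =
      (r + s - q) / (p - q) * NehariSystem.couplingPart r s h w := by
    field_simp
    linear_combination h2 - q * h1
  have e2 : NehariSystem.normW w ^ p =
      (r + s - q) / (r + s - p) * NehariSystem.concavePart q f g lam mu w := by
    field_simp
    linear_combination (r + s) * h1 - h2
  have hlt := hA (NehariSystem.normW w ^ p) (|lam| + |mu|) hpos (by linarith) (by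
    refine e1.le.trans ?_
    rw [mul_assoc]
    exact mul_le_mul_of_nonneg_left (hH w) (by positivity))
  refine absurd (e2.le.trans (mul_le_mul_of_nonneg_left (hB lam mu w) (by positivity))) ?_
  rw [not_le]
  refine lt_of_eq_of_lt ?_ hlt
  ring
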